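/- Let $\Bbbk$ be a field and let $m,n\ge 0$ be integers. Put $[m]=\{1<\dots<m\}$ and $[n]_0=\{0<1<\dots<n\}$, and let $\mathrm{Hom}([m],[n]_0)$ be the poset of isotone maps $[m]\to[n]_0$ with the pointwise order. A *poset ideal* is a down-closed subset. An ideal $I$ of a polynomial ring $\Bbbk[x_1,\dots,x_d]$ is *strongly stable* if it is generated by monomials and, for every monomial $u$ and all $i<j$, $x_ju\in I$ implies $x_iu\in I$. It is *$r$-regular* if its Castelnuovo–Mumford regularity is at most $r$, i.e. $I$ has a graded free resolution $\cdots\to F_1\to F_0\to I\to 0$ by finitely generated graded free modules with every $F_i$ generated in degrees $\le r+i$ (the zero ideal is $r$-regular for every $r$). For $\varphi\in\mathrm{Hom}([m],[n]_0)$ let $\Lambda\varphi=\{(a,i)\mid \varphi(q)\le i<\varphi(a)\text{ for all }q<a\}$ be its ascent and let $\varphi^{T}\in \mathrm{Hom}([n],[m]_0)$, $\varphi^{T}(b)=\#\{a\in[m]\mid \varphi(a)> n-b\}$, be the dual partition. For a poset ideal $\mathcal J\subseteq \mathrm{Hom}([m],[n]_0)$ let $L^{p_1}(\mathcal J)\subseteq\Bbbk[x_1,\dots,x_m]$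 be the projected letterplace ideal, generated by the monomials $\prod_{(a,i)\in\Lambda\varphi}x_a$ with $\varphi\notin\mathcal J$; let $L^{p_2}(\mathcal J)\subseteq\Bbbk[x_0,\dots,x_{n-1}]$ be the projected co-letterplace ideal, generated by the monomials $\prod_{a:\,\varphi(a)<n}x_{\varphi(a)}$ with $\varphi\in\mathcal J$. Write $\Bbbk[x_{[n]}]$ for a polynomial ring in $n$ ordered variables, identified with $\Bbbk[x_0,\dots,x_{n-1}]$ in the order-preserving way. Then: 1. $\varphi\mapsto\varphi^{T}$ is an isomorphism of posets $\tau:\mathrm{Hom}([m],[n]_0)\to\mathrm{Hom}([n],[m]_0)$. 2. $\mathcal J\mapsto L^{p_1}(\mathcal J)$ is a bijection from the poset ideals $\mathcal J\subseteq\mathrm{Hom}([m],[n]_0)$ onto the strongly stable $n$-regular ideals in $\Bbbk[x_{[m]}]$. 3. $\mathcal J\mapsto L^{p_1}(\tau(\mathcal J))$ is a bijection from the poset ideals $\mathcal J\subseteq\mathrm{Hom}([m],[n]_0)$ onto the strongly stable $m$-regular ideals in $\Bbbk[x_{[n]}]$. 4. $\mathcal J\mapsto L^{p_2}(\mathcal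 J)$ is a bijection from the poset ideals $\mathcal J\subseteq\mathrm{Hom}([m],[n]_0)$ onto the strongly stable $m$-regular ideals in $\Bbbk[x_{[n]}]$. In particular there are one-to-one correspondences between strongly stable $n$-regular ideals in $\Bbbk[x_{[m]}]$, poset ideals of $\mathrm{Hom}([m],[n]_0)\cong\mathrm{Hom}([n],[m]_0)$, and strongly stable $m$-regular ideals in $\Bbbk[x_{[n]}]$. -/

import Mathlib

open MvPolynomial

noncomputable section

namespace StronglyStableDuality

/-- `Hom([m], [n]₀)`, the poset of isotone maps from `[m] = {1 < ⋯ < m}` to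
`[n]₀ = {0 < 1 < ⋯ < n}`, ordered pointwise. The element `a` of `[m]` is represented by the
element `a - 1` of `Fin m`; the element `i` of `[n]₀` is represented by `i : Fin (n + 1)`. -/
abbrev IsotoneMaps (m n : ℕ) : Type := Fin m →o Fin (n + 1)

/-- The partition dual to `φ`. An isotone map `φ : [m] → [n]₀` is the same as the poset filter
`U = {(a, b) | b > n - φ a}` of `[m] × [n]`, that is, the isotone map `[m] × [n] → [1]₀` obtained
from `[n]₀ ≅ Hom([n], [1]₀)`; the dual partition sends `b ∈ [n]` to the number of `a ∈ [m]` with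
`(a, b) ∈ U`. (With `b` represented by `b - 1 : Fin n`, the condition is `n ≤ φ a + (b - 1)`.) -/
def dualPartition {m n : ℕ} (φ : IsotoneMaps m n) : IsotoneMaps n m where
  toFun b := ⟨(Finset.univ.filter fun a : Fin m => n ≤ (φ a : ℕ) + (b : ℕ)).card,
    Nat.lt_succ_of_le ((Finset.card_le_univ _).trans_eq (Fintype.card_fin m))⟩
  monotone' := by
    intro b c hbc
    refine Fin.mk_le_mk.mpr (Finset.card_le_card ?_)
    intro a ha
    have h : (b : ℕ) ≤ (c : ℕ) := hbc
    simp only [Finset.mem_filter, Finset.mem_univ, true_and] at ha ⊢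
    omega

/-- The ascent `Λφ = {(a, i) | φ q ≤ i < φ a for all q < a}` of `φ : [m] → [n]₀`. It consists of
pairs with `0 ≤ i ≤ n - 1`. -/
def ascent {m n : ℕ} (φ : IsotoneMaps m n) : Finset (Fin m × Fin n) :=
  Finset.univ.filter fun x => x.2.castSucc < φ x.1 ∧ ∀ q < x.1, φ q ≤ x.2.castSucc

/-- The part of the graph of `φ : [m] → [n]₀` that lies in `[m] × {0, …, n - 1}`. It is the graph
of the restriction of `φ` to the poset ideal `{a | φ a < n}` of `[m]`. -/
def lowGraph {m n : ℕ} (φ : IsotoneMaps m n) : Finset (Fin m × Fin n) :=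
  Finset.univ.filter fun x => φ x.1 = x.2.castSucc

/-- The letterplace ideal of a poset ideal `J ⊆ Hom([m], [n]₀)`, generated by the squarefree
monomials of the ascents `Λφ` with `φ ∉ J`. -/
def letterplaceIdeal (k : Type*) [Field k] {m n : ℕ} (J : LowerSet (IsotoneMaps m n)) :
    Ideal (MvPolynomial (Fin m × Fin n) k) :=
  Ideal.span {p | ∃ φ : IsotoneMaps m n, φ ∉ J ∧ p = ∏ x ∈ ascent φ, X x}

/-- The ideal of `k[x_{[m]}]` generated by the image of the letterplace ideal under the projection
`x_{a,i} ↦ x_a`. -/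
def projectedLetterplaceIdeal (k : Type*) [Field k] {m n : ℕ} (J : LowerSet (IsotoneMaps m n)) :
    Ideal (MvPolynomial (Fin m) k) :=
  (letterplaceIdeal k J).map (rename (Prod.fst : Fin m × Fin n → Fin m) :
    MvPolynomial (Fin m × Fin n) k →ₐ[k] MvPolynomial (Fin m) k)

/-- The co-letterplace ideal of a poset ideal `J ⊆ Hom([m], [n]₀)`, generated by the squarefree
monomials of the graphs of the markers of `J`. A marker is an isotone map `α` from a poset ideal
of `[m]` to `{0, …, n - 1}` all of whose isotone extensions `[m] → [n]₀` lie in `J`. As `J` is a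
poset ideal, it is enough that the largest extension, which has the value `n` off the domain of
`α`, lies in `J`; so the markers are the restrictions of the `φ ∈ J` to `{a | φ a < n}`. -/
def coLetterplaceIdeal (k : Type*) [Field k] {m n : ℕ} (J : LowerSet (IsotoneMaps m n)) :
    Ideal (MvPolynomial (Fin m × Fin n) k) :=
  Ideal.span {p | ∃ φ : IsotoneMaps m n, φ ∈ J ∧ p = ∏ x ∈ lowGraph φ, X x}

/-- The ideal of `k[x_0, …, x_{n-1}]`, a polynomial ring in `n` variables, generated by the image
of the co-letterplace ideal under the projection `x_{a,i} ↦ x_i`. -/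
def projectedCoLetterplaceIdeal (k : Type*) [Field k] {m n : ℕ}
    (J : LowerSet (IsotoneMaps m n)) : Ideal (MvPolynomial (Fin n) k) :=
  (coLetterplaceIdeal k J).map (rename (Prod.snd : Fin m × Fin n → Fin n) :
    MvPolynomial (Fin m × Fin n) k →ₐ[k] MvPolynomial (Fin n) k)

/-- Strongly stable ideals: monomial ideals such that, for every monomial `u`,
`x_j u ∈ I` and `i < j` imply `x_i u ∈ I`. -/
structure IsStronglyStable {k : Type*} [Field k] {d : ℕ} (I : Ideal (MvPolynomial (Fin d) k)) :
    Prop where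
  isMonomial : ∃ S : Set (Fin d →₀ ℕ), I = Ideal.span ((fun s => monomial s (1 : k)) '' S)
  exchange : ∀ (u : Fin d →₀ ℕ) (i j : Fin d), i < j →
    X j * monomial u (1 : k) ∈ I → X i * monomial u (1 : k) ∈ I

/-- A graded free resolution `⋯ → F₁ → F₀ → I → 0` of an ideal `I` of the standard graded
polynomial ring `S = k[x_1, …, x_d]`. Here `F i` is the graded free module of finite rank with a
basis indexed by `ι i`, the basis vector `j` having degree `deg i j`, i.e.
`F i = ⨁ j, S(-deg i j)`, and all maps are homogeneous of degree zero. -/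
structure GradedFreeResolution {k : Type*} [Field k] {d : ℕ}
    (I : Ideal (MvPolynomial (Fin d) k)) where
  ι : ℕ → Type
  finite : ∀ i, Finite (ι i)
  deg : ∀ i, ι i → ℕ
  aug : (ι 0 →₀ MvPolynomial (Fin d) k) →ₗ[MvPolynomial (Fin d) k] MvPolynomial (Fin d) k
  diff : ∀ i, (ι (i + 1) →₀ MvPolynomial (Fin d) k) →ₗ[MvPolynomial (Fin d) k]
    (ι i →₀ MvPolynomial (Fin d) k)
  aug_homogeneous : ∀ j, (aug (Finsupp.single j 1)).IsHomogeneous (deg 0 j)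
  diff_homogeneous : ∀ i j l, ∀ s ∈ (diff i (Finsupp.single j 1) l).support,
    s.degree + deg i l = deg (i + 1) j
  range_aug : LinearMap.range aug = I
  exact_zero : LinearMap.range (diff 0) = LinearMap.ker aug
  exact_succ : ∀ i, LinearMap.range (diff (i + 1)) = LinearMap.ker (diff i)

/-- Castelnuovo–Mumford regularity: an ideal `I` is `r`-regular if it has a graded free resolution
whose `i`-th module is generated in degrees at most `r + i`, for every `i`. -/
def IsRegular {k : Type*} [Field k] {d : ℕ} (r : ℕ) (I : Ideal (MvPolynomial (Fin d) k)) : Prop :=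
  ∃ F : GradedFreeResolution I, ∀ i j, F.deg i j ≤ r + i

/-- The set of strongly stable `r`-regular ideals in `k[x_{[d]}]`. -/
abbrev StronglyStableRegularIdeals (k : Type*) [Field k] (d r : ℕ) : Type _ :=
  {I : Ideal (MvPolynomial (Fin d) k) // IsStronglyStable I ∧ IsRegular r I}

end StronglyStableDuality

end

/-!
An isotone map `φ : [m] → [n]₀` is the sequence of partial sums of a unique exponent vector of
degree at most `n` in `m` variables, namely of the exponent `ascentExponent φ` of
`∏_{(a, i) ∈ Λφ} x_a`. Multiplying a monomial by a variable or exchanging a variable for a smaller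
one increases the partial sums, and conversely any increase of the partial sums is a composite of
such operations (`of_partialSum_le`). So the complement of a poset ideal `J` is the same as a set
of monomials of degree at most `n` that is closed, within these degrees, under multiplication and
exchange, and the monomials of the projected letterplace ideal of `J` are those whose partial sums,
cut off at `n`, form a map outside of `J` (`monomial_mem_projectedLetterplaceIdeal`). Hence
`J ↦ L^{p₁}(J)` is a bijection onto the strongly stable ideals generated in degrees at most `n`.

A strongly stable ideal is `n`-regular if and only if it is generated in degrees at most `n`. One
direction reads off generators from a resolution (`IsRegular.le_span`). For the other, order the
minimal monomial generators by degree and then by weight: each of them has a colon ideal generated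
by variables modulo the previous ones (`IsStable.exists_le_add_iff`). The class of graded
submodules of free modules having such linear quotients in degrees at most `r` is closed under
passing to the relations among the generators, with `r` replaced by `r + 1`
(`LinearQuotients.exists_presentation`), so iterating gives a resolution as required
(`isRegular_of_linearQuotients`).

Dual partitions correspond to transposed filters of `[m] × [n]` (`le_dualPartition_add_iff`), so
taking them is an isomorphism. Turning both chains around makes it into the order-reversing
bijection sending `φ` to `i ↦ #{a | φ a ≤ i}`. These numbers are the partial sums of the exponents
of the monomial of the graph of `φ`, so `L^{p₂}(J)` is the projected letterplace ideal of the
complement of the image of `J` (`projectedCoLetterplaceIdeal_eq`).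
-/

noncomputable section

namespace StronglyStableDuality

/-! ### Graded submodules of free modules with linear quotients -/

section LinearQuotients

variable {σ R ι κ : Type*} [CommRing R]

/-- The element `f` of the graded free module `⨁ l, S(-deg l)` is homogeneous of degree `n`. -/
def IsHomogeneousVector (deg : ι → ℕ) (n : ℕ) (f : ι →₀ MvPolynomial σ R) : Prop :=
  ∀ l s, coeff s (f l) ≠ 0 → s.degree + deg l = n

lemma IsHomogeneousVector.zero (deg : ι → ℕ) (n : ℕ) :
    IsHomogeneousVector deg n (0 : ι →₀ MvPolynomial σ R) := by
  intro l s h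
  simp at h

lemma IsHomogeneousVector.add {deg : ι → ℕ} {n : ℕ} {f g : ι →₀ MvPolynomial σ R}
    (hf : IsHomogeneousVector deg n f) (hg : IsHomogeneousVector deg n g) :
    IsHomogeneousVector deg n (f + g) := by
  intro l s h
  by_contra hs
  refine h ?_
  rw [Finsupp.add_apply, coeff_add, not_not.mp fun h' => hs (hf l s h'),
    not_not.mp fun h' => hs (hg l s h'), add_zero]

lemma IsHomogeneousVector.sub {deg : ι → ℕ} {n : ℕ} {f g : ι →₀ MvPolynomial σ R}
    (hf : IsHomogeneousVector deg n f) (hg : IsHomogeneousVector deg n g) :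
    IsHomogeneousVector deg n (f - g) := by
  intro l s h
  by_contra hs
  refine h ?_
  rw [Finsupp.sub_apply, coeff_sub, not_not.mp fun h' => hs (hf l s h'),
    not_not.mp fun h' => hs (hg l s h'), sub_zero]

lemma IsHomogeneousVector.monomial_smul {deg : ι → ℕ} {n : ℕ} {f : ι →₀ MvPolynomial σ R}
    (hf : IsHomogeneousVector deg n f) (t : σ →₀ ℕ) (a : R) :
    IsHomogeneousVector deg (t.degree + n) (monomial t a • f) := by
  intro l s h
  rw [Finsupp.smul_apply, smul_eq_mul, coeff_monomial_mul'] at h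
  split_ifs at h with hts
  · rw [← hf l (s - t) (right_ne_zero_of_mul h), ← add_assoc, ← map_add, add_tsub_cancel_of_le hts]
  · exact absurd rfl h

lemma IsHomogeneousVector.single {deg : ι → ℕ} {n : ℕ} {l : ι} {p : MvPolynomial σ R}
    (hp : ∀ s, coeff s p ≠ 0 → s.degree + deg l = n) :
    IsHomogeneousVector deg n (Finsupp.single l p) := by
  classical
  intro l' s h
  rw [Finsupp.single_apply] at h
  split_ifs at h with hl
  · exact hl ▸ hp s h
  · simp at h

/-- A homogeneous element of the image of a graded map of free modules is the image of a
homogeneous element. -/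
lemma exists_isHomogeneousVector_preimage {deg : ι → ℕ} {deg' : κ → ℕ}
    {v : κ → ι →₀ MvPolynomial σ R} (hv : ∀ j, IsHomogeneousVector deg (deg' j) (v j))
    {n : ℕ} {c : κ →₀ MvPolynomial σ R}
    (hc : IsHomogeneousVector deg n (Finsupp.linearCombination (MvPolynomial σ R) v c)) :
    ∃ c', IsHomogeneousVector deg' n c' ∧
      Finsupp.linearCombination (MvPolynomial σ R) v c' =
        Finsupp.linearCombination (MvPolynomial σ R) v c := by
  classical
  -- The vector `c'` is the component of degree `n` of `c`; graded maps commute with taking it.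
  have key : ∀ c : κ →₀ MvPolynomial σ R, ∃ c', IsHomogeneousVector deg' n c' ∧
      ∀ l s, coeff s (Finsupp.linearCombination (MvPolynomial σ R) v c' l) =
        if s.degree + deg l = n then
          coeff s (Finsupp.linearCombination (MvPolynomial σ R) v c l) else 0 := by
    have hadd : ∀ c₁ c₂ : κ →₀ MvPolynomial σ R,
        (∃ c', IsHomogeneousVector deg' n c' ∧
          ∀ l s, coeff s (Finsupp.linearCombination (MvPolynomial σ R) v c' l) =
            if s.degree + deg l = n then
              coeff s (Finsupp.linearCombination (MvPolynomial σ R) v c₁ l) else 0) →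
        (∃ c', IsHomogeneousVector deg' n c' ∧
          ∀ l s, coeff s (Finsupp.linearCombination (MvPolynomial σ R) v c' l) =
            if s.degree + deg l = n then
              coeff s (Finsupp.linearCombination (MvPolynomial σ R) v c₂ l) else 0) →
        ∃ c', IsHomogeneousVector deg' n c' ∧
          ∀ l s, coeff s (Finsupp.linearCombination (MvPolynomial σ R) v c' l) =
            if s.degree + deg l = n then
              coeff s (Finsupp.linearCombination (MvPolynomial σ R) v (c₁ + c₂) l) else 0 := by
      rintro c₁ c₂ ⟨d₁, h₁, e₁⟩ ⟨d₂, h₂, e₂⟩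
      refine ⟨d₁ + d₂, h₁.add h₂, fun l s => ?_⟩
      rw [map_add, map_add, Finsupp.add_apply, Finsupp.add_apply, coeff_add, coeff_add, e₁, e₂]
      split_ifs <;> simp
    intro c
    induction c using Finsupp.induction_linear with
    | zero => exact ⟨0, .zero _ _, fun l s => by simp⟩
    | add f g hf hg => exact hadd f g hf hg
    | single j p =>
      induction p using MvPolynomial.induction_on' with
      | add p q hp hq => rw [Finsupp.single_add]; exact hadd _ _ hp hq
      | monomial t a =>
        have hhom := (hv j).monomial_smul t a
        by_cases h : t.degree + deg' j = n
        · refine ⟨Finsupp.single j (monomial t a), .single fun s hs => ?_, fun l s => ?_⟩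
          · rw [coeff_monomial] at hs
            split_ifs at hs with hts
            · exact hts ▸ h
            · exact absurd rfl hs
          · rw [Finsupp.linearCombination_single]
            split_ifs with hs
            · rfl
            · exact not_not.mp fun h' => hs ((hhom l s h').trans h)
        · refine ⟨0, .zero _ _, fun l s => ?_⟩
          rw [Finsupp.linearCombination_single, map_zero, Finsupp.zero_apply, coeff_zero]
          split_ifs with hs
          · exact (not_not.mp fun h' => h ((hhom l s h').symm.trans hs)).symm
          · rfl
  obtain ⟨c', h, e⟩ := key c
  refine ⟨c', h, ?_⟩
  ext l s
  rw [e]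
  split_ifs with hs
  · rfl
  · exact (not_not.mp fun h' => hs (hc l s h')).symm

/-- A submodule of the graded free module `⨁ l, S(-deg l)` has *linear quotients* in degrees at
most `r` if it can be built up from `0` by adjoining homogeneous generators of degree at most `r`,
one at a time, each of which has a colon ideal generated by variables modulo the submodule
generated by the preceding ones. -/
inductive LinearQuotients (deg : ι → ℕ) (r : ℕ) :
    Submodule (MvPolynomial σ R) (ι →₀ MvPolynomial σ R) → Prop
  | bot : LinearQuotients deg r ⊥
  | adjoin {N : Submodule (MvPolynomial σ R) (ι →₀ MvPolynomial σ R)}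
      (g : ι →₀ MvPolynomial σ R) (e : ℕ) (A : Finset σ) (hN : LinearQuotients deg r N)
      (hg : IsHomogeneousVector deg e g) (he : e ≤ r)
      (hA : ∀ p : MvPolynomial σ R, p • g ∈ N ↔ p ∈ Ideal.span (X '' (A : Set σ))) :
      LinearQuotients deg r (N ⊔ Submodule.span _ {g})

/-- Linear quotients are preserved by the inclusion of a direct summand. -/
lemma LinearQuotients.map_lmapDomain_some {deg : Option κ → ℕ} {r : ℕ}
    {N : Submodule (MvPolynomial σ R) (κ →₀ MvPolynomial σ R)}
    (hN : LinearQuotients (deg ∘ some) r N) :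
    LinearQuotients deg r
      (N.map (Finsupp.lmapDomain (MvPolynomial σ R) (MvPolynomial σ R) (some : κ → Option κ))) := by
  have hinj : Function.Injective
      (Finsupp.lmapDomain (MvPolynomial σ R) (MvPolynomial σ R) (some : κ → Option κ)) :=
    Finsupp.mapDomain_injective (Option.some_injective κ)
  induction hN with
  | bot => rw [Submodule.map_bot]; exact .bot
  | @adjoin N g e A hN hg he hA ih =>
    rw [Submodule.map_sup, Submodule.map_span, Set.image_singleton]
    refine .adjoin _ e A ih ?_ he fun p => ?_
    · rintro (_ | l) s h
      · rw [Finsupp.lmapDomain_apply, Finsupp.mapDomain_of_notMem_range _ _ (by simp)] at h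
        simp at h
      · rw [Finsupp.lmapDomain_apply,
          Finsupp.mapDomain_apply (Option.some_injective κ)] at h
        exact hg l s h
    · rw [← hA, ← map_smul, Submodule.mem_map]
      exact ⟨fun ⟨x, hx, e⟩ => hinj e ▸ hx, fun h => ⟨_, h, rfl⟩⟩

lemma mem_span_X_of_mul_X_mem {B : Finset σ} {i : σ} (hi : i ∉ B) {p : MvPolynomial σ R}
    (h : p * X i ∈ Ideal.span (X '' (B : Set σ))) : p ∈ Ideal.span (X '' (B : Set σ)) := by
  classical
  rw [mem_ideal_span_X_image] at h ⊢
  intro s hs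
  obtain ⟨j, hj, hsj⟩ := h (s + Finsupp.single i 1) (by
    rw [support_mul_X]; exact Finset.mem_map_of_mem _ hs)
  refine ⟨j, hj, ?_⟩
  rwa [Finsupp.add_apply, Finsupp.single_eq_of_ne (by rintro rfl; exact hi hj), add_zero] at hsj

/-- A submodule with linear quotients is the image of a graded free module whose relations have
linear quotients again, with degrees going up by one: each adjoined generator `g` with colon ideal
`(X i : i ∈ A)` contributes one relation for every `i ∈ A`, expressing `X i • g` by the preceding
generators, and the colon ideals of these relations are again generated by variables. -/
lemma LinearQuotients.exists_presentation {deg : ι → ℕ} {r : ℕ}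
    {N : Submodule (MvPolynomial σ R) (ι →₀ MvPolynomial σ R)} (hN : LinearQuotients deg r N) :
    ∃ (κ : Type) (_ : Finite κ) (deg' : κ → ℕ) (v : κ → ι →₀ MvPolynomial σ R),
      (∀ j, deg' j ≤ r) ∧ (∀ j, IsHomogeneousVector deg (deg' j) (v j)) ∧
      LinearMap.range (Finsupp.linearCombination (MvPolynomial σ R) v) = N ∧
      LinearQuotients deg' (r + 1)
        (LinearMap.ker (Finsupp.linearCombination (MvPolynomial σ R) v)) := by
  classical
  induction hN with
  | bot =>
    refine ⟨Empty, inferInstance, Empty.elim, Empty.elim, fun j => j.elim, fun j => j.elim, ?_, ?_⟩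
    · rw [Finsupp.range_linearCombination, Set.range_eq_empty, Submodule.span_empty]
    · convert LinearQuotients.bot
      exact Subsingleton.elim _ _
  | @adjoin N g e A hN hg he hA ih =>
    obtain ⟨κ, hκ, deg', v, hdeg, hv, hrange, hker⟩ := ih
    set S := MvPolynomial σ R
    let deg'' : Option κ → ℕ := fun o => o.elim e deg'
    let v' : Option κ → ι →₀ S := fun o => o.elim g v
    let emb : (κ →₀ S) →ₗ[S] (Option κ →₀ S) := Finsupp.lmapDomain S S some
    have hemb_none : ∀ c, emb c none = 0 := fun c =>
      Finsupp.mapDomain_of_notMem_range _ _ (by simp)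
    have hemb : ∀ c, Finsupp.linearCombination S v' (emb c) = Finsupp.linearCombination S v c :=
      fun c => Finsupp.linearCombination_mapDomain S _ _
    have hker_emb : ∀ z, Finsupp.linearCombination S v' z = 0 → z none = 0 →
        z ∈ (LinearMap.ker (Finsupp.linearCombination S v)).map emb := by
      intro z hz hz0
      have hze : emb z.some = z := by
        ext1 o
        rcases o with _ | j
        · rw [hemb_none, hz0]
        · exact Finsupp.mapDomain_apply (Option.some_injective κ) _ _
      refine ⟨z.some, ?_, hze⟩
      rw [SetLike.mem_coe, LinearMap.mem_ker, ← hemb, hze, hz]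
    have hrel : ∀ i : σ, ∃ c : κ →₀ S, i ∈ A → IsHomogeneousVector deg' (1 + e) c ∧
        Finsupp.linearCombination S v c = (X i : S) • g := by
      intro i
      by_cases hi : i ∈ A
      · have hmem : (X i : S) • g ∈ N := (hA _).2 (Ideal.subset_span ⟨i, hi, rfl⟩)
        rw [← hrange] at hmem
        obtain ⟨c, hc⟩ := hmem
        have hXg := hg.monomial_smul (Finsupp.single i 1) 1
        rw [Finsupp.degree_single] at hXg
        obtain ⟨c', hc', h⟩ := exists_isHomogeneousVector_preimage hv (c := c) (n := 1 + e)
          (hc ▸ hXg)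
        exact ⟨c', fun _ => ⟨hc', h.trans hc⟩⟩
      · exact ⟨0, fun h => absurd h hi⟩
    choose c hc using hrel
    let h : σ → Option κ →₀ S := fun i => Finsupp.single none (X i) - emb (c i)
    have h_none : ∀ i, h i none = X i := fun i => by
      simp only [h, Finsupp.sub_apply, hemb_none, Finsupp.single_eq_same, sub_zero]
    have h_ker : ∀ i ∈ A, Finsupp.linearCombination S v' (h i) = 0 := fun i hi => by
      rw [map_sub, hemb, (hc i hi).2, Finsupp.linearCombination_single]
      exact sub_self _
    have h_hom : ∀ i ∈ A, IsHomogeneousVector deg'' (1 + e) (h i) := by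
      intro i hi
      refine .sub (.single fun s hs => ?_) ?_
      · rw [coeff_X] at hs
        split_ifs at hs with his
        · rw [← his, Finsupp.degree_single]; rfl
        · exact absurd rfl hs
      · rintro (_ | j) s hs
        · rw [hemb_none] at hs
          simp at hs
        · refine (hc i hi).1 j s ?_
          rwa [← Finsupp.mapDomain_apply (Option.some_injective κ) (c i) j]
    -- Taking the coordinate at `none` maps the span of the relations onto an ideal of variables.
    have hmap_none : ∀ B : Finset σ,
        (Submodule.span S (h '' (B : Set σ))).map (Finsupp.lapply none) =
          Ideal.span (X '' (B : Set σ)) := by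
      intro B
      rw [Submodule.map_span, ← Set.image_comp, Ideal.span]
      congr 1
      refine Set.image_congr fun i _ => h_none i
    let K := (LinearMap.ker (Finsupp.linearCombination S v)).map emb
    have hstep : ∀ B : Finset σ, B ⊆ A →
        LinearQuotients deg'' (r + 1) (K ⊔ Submodule.span S (h '' (B : Set σ))) := by
      intro B
      induction B using Finset.induction_on with
      | empty =>
        intro _
        rw [Finset.coe_empty, Set.image_empty, Submodule.span_empty, sup_bot_eq]
        exact LinearQuotients.map_lmapDomain_some (deg := deg'') hker
      | @insert i B hi ihB =>
        intro hBA
        rw [Finset.insert_subset_iff] at hBA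
        rw [Finset.coe_insert, Set.image_insert_eq, Submodule.span_insert,
          sup_comm (Submodule.span S {h i}), ← sup_assoc]
        refine .adjoin _ (1 + e) B (ihB hBA.2) (h_hom i hBA.1) (by omega)
          fun p => ⟨fun hp => ?_, ?_⟩
        · refine mem_span_X_of_mul_X_mem hi ?_
          obtain ⟨y, ⟨w, -, rfl⟩, z, hz, hyz⟩ := Submodule.mem_sup.1 hp
          have hz' : z none = p * X i := by
            rw [← h_none i, ← smul_eq_mul, ← Finsupp.smul_apply, ← hyz, Finsupp.add_apply,
              hemb_none, zero_add]
          rw [← hz', ← hmap_none]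
          exact ⟨z, hz, rfl⟩
        · suffices Ideal.span (X '' (B : Set σ)) ≤
              (K ⊔ Submodule.span S (h '' (B : Set σ))).comap (LinearMap.toSpanSingleton S _ (h i))
            from fun hp => this hp
          rw [Ideal.span_le]
          rintro _ ⟨j, hj, rfl⟩
          change (X j : S) • h i ∈ K ⊔ Submodule.span S (h '' (B : Set σ))
          have hjA := hBA.2 hj
          rw [← sub_add_cancel ((X j : S) • h i) ((X i : S) • h j)]
          refine add_mem (Submodule.mem_sup_left (hker_emb _ ?_ ?_))
            (Submodule.mem_sup_right (Submodule.smul_mem _ _ (Submodule.subset_span ⟨j, hj, rfl⟩)))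
          · rw [map_sub, map_smul, map_smul, h_ker i hBA.1, h_ker j hjA, smul_zero, smul_zero,
              sub_zero]
          · rw [Finsupp.sub_apply, Finsupp.smul_apply, Finsupp.smul_apply, h_none, h_none,
              smul_eq_mul, smul_eq_mul, mul_comm, sub_self]
    refine ⟨Option κ, inferInstance, deg'', v', ?_, ?_, ?_, ?_⟩
    · rintro (_ | j)
      exacts [he, hdeg j]
    · rintro (_ | j)
      exacts [hg, hv j]
    · rw [← hrange, Finsupp.range_linearCombination, Finsupp.range_linearCombination,
        ← Submodule.span_union]
      congr 1
      ext x
      simp only [Set.mem_range, Option.exists, Set.mem_union, Set.mem_singleton_iff, v',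
        Option.elim_none, Option.elim_some]
      rw [or_comm, eq_comm]
    · convert hstep A subset_rfl using 1
      refine le_antisymm (fun z hz => ?_) (sup_le ?_ ?_)
      · rw [LinearMap.mem_ker] at hz
        have hz0 : z none ∈ Ideal.span (X '' (A : Set σ)) := by
          rw [← hA, ← hrange]
          refine ⟨-z.some, ?_⟩
          rw [Finsupp.linearCombination_option] at hz
          rw [map_neg]
          exact (eq_neg_of_add_eq_zero_left hz).symm
        rw [← hmap_none] at hz0
        obtain ⟨y, hy, hyz⟩ := hz0
        have hy0 : Finsupp.linearCombination S v' y = 0 := by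
          have : Submodule.span S (h '' (A : Set σ)) ≤
              LinearMap.ker (Finsupp.linearCombination S v') := by
            rw [Submodule.span_le]
            rintro _ ⟨i, hi, rfl⟩
            exact h_ker i hi
          exact this hy
        rw [← sub_add_cancel z y]
        refine add_mem (Submodule.mem_sup_left (hker_emb _ ?_ ?_)) (Submodule.mem_sup_right hy)
        · rw [map_sub, hz, hy0, sub_zero]
        · rw [Finsupp.sub_apply, ← hyz, Finsupp.lapply_apply, sub_self]
      · rintro _ ⟨w, hw, rfl⟩
        rw [LinearMap.mem_ker, hemb]
        exact hw
      · rw [Submodule.span_le]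
        rintro _ ⟨i, hi, rfl⟩
        exact h_ker i hi

end LinearQuotients

/-! ### Resolutions of ideals with linear quotients -/

section Resolution

variable {k : Type*} [Field k] {d : ℕ}

/-- A graded free module of finite rank with a submodule that has linear quotients in degrees at
most `r`; the successive syzygy modules of a resolution are such pairs. -/
structure SyzygyModule (k : Type*) [Field k] (d r : ℕ) where
  ι : Type
  finite : Finite ι
  deg : ι → ℕ
  N : Submodule (MvPolynomial (Fin d) k) (ι →₀ MvPolynomial (Fin d) k)
  linearQuotients : LinearQuotients deg r N

/-- The generators of `M'` map to homogeneous generators `v` of the submodule `M.N`, with `M'.N` as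
module of relations. -/
def SyzygyModule.IsPresentation {r r' : ℕ} (M : SyzygyModule k d r) (M' : SyzygyModule k d r')
    (v : M'.ι → M.ι →₀ MvPolynomial (Fin d) k) : Prop :=
  (∀ j, M'.deg j ≤ r) ∧ (∀ j, IsHomogeneousVector M.deg (M'.deg j) (v j)) ∧
    LinearMap.range (Finsupp.linearCombination (MvPolynomial (Fin d) k) v) = M.N ∧
    LinearMap.ker (Finsupp.linearCombination (MvPolynomial (Fin d) k) v) = M'.N

lemma SyzygyModule.exists_isPresentation {r : ℕ} (M : SyzygyModule k d r) :
    ∃ (M' : SyzygyModule k d (r + 1)) (v : M'.ι → M.ι →₀ MvPolynomial (Fin d) k),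
      M.IsPresentation M' v := by
  obtain ⟨κ, hκ, deg', v, h₁, h₂, h₃, h₄⟩ := M.linearQuotients.exists_presentation
  exact ⟨⟨κ, hκ, deg', _, h₄⟩, v, h₁, h₂, h₃, rfl⟩

lemma SyzygyModule.exists_sequence {r : ℕ} (M₀ : SyzygyModule k d r) :
    ∃ (M : ∀ i, SyzygyModule k d (r + i)), M 0 = M₀ ∧
      ∀ i, ∃ v, (M i).IsPresentation (M (i + 1)) v :=
  ⟨fun i => i.rec M₀ fun _ M => M.exists_isPresentation.choose, rfl,
    fun _ => (SyzygyModule.exists_isPresentation _).choose_spec⟩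

/-- An ideal with linear quotients in degrees at most `r` is `r`-regular. Here the polynomial ring
is the free module with one basis element, of degree `0`. -/
theorem isRegular_of_linearQuotients {r : ℕ} {I : Ideal (MvPolynomial (Fin d) k)}
    (hI : LinearQuotients (fun _ : Unit => 0) r
      (Submodule.map (Finsupp.lsingle ()) I)) : IsRegular r I := by
  obtain ⟨M₀, v₀, hdeg₀, hhom₀, hrange₀, hker₀⟩ :=
    SyzygyModule.exists_isPresentation
      (⟨Unit, inferInstance, fun _ => 0, _, hI⟩ : SyzygyModule k d r)
  obtain ⟨M, rfl, hM⟩ := M₀.exists_sequence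
  choose v hdeg hhom hrange hker using hM
  refine ⟨{ ι := fun i => (M i).ι
            finite := fun i => (M i).finite
            deg := fun i => (M i).deg
            aug := Finsupp.lapply () ∘ₗ Finsupp.linearCombination _ v₀
            diff := fun i => Finsupp.linearCombination _ (v i)
            aug_homogeneous := ?_
            diff_homogeneous := ?_
            range_aug := ?_
            exact_zero := ?_
            exact_succ := fun i => (hrange (i + 1)).trans (hker i).symm }, ?_⟩
  · intro j s hs
    rw [LinearMap.comp_apply, Finsupp.linearCombination_single, one_smul] at hs
    have h : s.degree = (M 0).deg j := hhom₀ j () s hs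
    rwa [Finsupp.degree_eq_weight_one] at h
  · intro i j l s hs
    rw [Finsupp.linearCombination_single, one_smul, mem_support_iff] at hs
    exact hhom i j l s hs
  · rw [LinearMap.range_comp, hrange₀, ← Submodule.map_comp]
    refine (congrArg (fun f => Submodule.map f I) (LinearMap.ext fun x => ?_)).trans
      (Submodule.map_id I)
    exact Finsupp.single_eq_same
  · rw [hrange, ← hker₀]
    ext x
    rw [LinearMap.mem_ker, LinearMap.mem_ker, LinearMap.comp_apply, Finsupp.lapply_apply]
    exact ⟨fun h => DFunLike.congr_fun h (), fun h => Finsupp.ext fun _ => h⟩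
  · rintro (_ | i) j
    · exact hdeg₀ j
    · exact (hdeg i j).trans_eq (by omega)

end Resolution

/-! ### Strongly stable ideals have linear quotients -/

section StronglyStable

variable {k : Type*} [Field k] {d : ℕ}

/-- The ideal generated by the monomials with exponents in `G`. -/
def monomialIdeal (k : Type*) [Field k] {d : ℕ} (G : Set (Fin d →₀ ℕ)) :
    Ideal (MvPolynomial (Fin d) k) :=
  Ideal.span ((fun s => monomial s (1 : k)) '' G)

lemma mem_monomialIdeal {G : Set (Fin d →₀ ℕ)} {p : MvPolynomial (Fin d) k} :
    p ∈ monomialIdeal k G ↔ ∀ s ∈ p.support, ∃ w ∈ G, w ≤ s :=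
  mem_ideal_span_monomial_image

lemma monomial_mem_monomialIdeal {G : Set (Fin d →₀ ℕ)} {s : Fin d →₀ ℕ} :
    monomial s (1 : k) ∈ monomialIdeal k G ↔ ∃ w ∈ G, w ≤ s := by
  classical
  rw [mem_monomialIdeal, support_monomial, if_neg one_ne_zero]
  simp

/-- The set `G` of exponents is stable if exchanging a variable for a smaller one preserves
divisibility by some monomial with exponent in `G`. As `G` need not contain all exponents of the
ideal it generates, the result of an exchange only has to be a multiple of an element of `G`. -/
def IsStable (G : Set (Fin d →₀ ℕ)) : Prop :=
  ∀ (v : Fin d →₀ ℕ) (i j : Fin d), i < j →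
    (∃ w ∈ G, w ≤ v + Finsupp.single j 1) → ∃ w ∈ G, w ≤ v + Finsupp.single i 1

lemma X_mul_monomial_one (u : Fin d →₀ ℕ) (i : Fin d) :
    (X i * monomial u 1 : MvPolynomial (Fin d) k) = monomial (u + Finsupp.single i 1) 1 := by
  rw [mul_comm, X, monomial_mul, one_mul]

lemma IsStable.isStronglyStable {G : Set (Fin d →₀ ℕ)} (hG : IsStable G) :
    IsStronglyStable (monomialIdeal k G) where
  isMonomial := ⟨G, rfl⟩
  exchange u i j hij h := by
    rw [X_mul_monomial_one, monomial_mem_monomialIdeal] at h ⊢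
    exact hG u i j hij h

lemma exists_eq_add_single {v : Fin d →₀ ℕ} {i : Fin d} (h : v i ≠ 0) :
    ∃ v₀, v = v₀ + Finsupp.single i 1 :=
  ⟨v - Finsupp.single i 1, (tsub_add_cancel_of_le
    (Finsupp.single_le_iff.2 (Nat.one_le_iff_ne_zero.2 h))).symm⟩

lemma le_of_le_add_single {v w : Fin d →₀ ℕ} {i : Fin d} (h : w ≤ v + Finsupp.single i 1)
    (hi : w i ≤ v i) : w ≤ v := by
  intro l
  have := h l
  rw [Finsupp.add_apply, Finsupp.single_apply] at this
  split_ifs at this with hl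
  · exact hl ▸ hi
  · exact this

lemma eq_of_le_of_degree_le {v w : Fin d →₀ ℕ} (h : v ≤ w) (hd : w.degree ≤ v.degree) :
    v = w := by
  obtain ⟨c, rfl⟩ := exists_add_of_le h
  have hc : c = 0 := by
    rw [← Finsupp.degree_eq_zero_iff]
    rw [map_add] at hd
    omega
  rw [hc, add_zero]

/-- The weight of a monomial, in which the variable of index `i` counts `i`. Exchanging a variable
for a smaller one lowers it. -/
def indexWeight (v : Fin d →₀ ℕ) : ℕ := Finsupp.weight (fun i : Fin d => (i : ℕ)) v

lemma indexWeight_add_single (v : Fin d →₀ ℕ) (i : Fin d) :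
    indexWeight (v + Finsupp.single i 1) = indexWeight v + i := by
  simp [indexWeight, Finsupp.weight_single]

/-- A generator `u` of a finite set of exponents that is maximal for the degree and, within its
degree, for the weight `indexWeight`. -/
def IsLastGenerator (G : Finset (Fin d →₀ ℕ)) (u : Fin d →₀ ℕ) : Prop :=
  u ∈ G ∧ ∀ w ∈ G, w.degree < u.degree ∨ w.degree = u.degree ∧ indexWeight w ≤ indexWeight u

lemma exists_isLastGenerator {G : Finset (Fin d →₀ ℕ)} (hG : G.Nonempty) :
    ∃ u, IsLastGenerator G u := by
  obtain ⟨u, hu, h⟩ := G.exists_max_image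
    (fun w => toLex (w.degree, indexWeight w)) hG
  exact ⟨u, hu, fun w hw => Prod.Lex.toLex_le_toLex.1 (h w hw)⟩

lemma IsLastGenerator.degree_le {G : Finset (Fin d →₀ ℕ)} {u w : Fin d →₀ ℕ}
    (hu : IsLastGenerator G u) (hw : w ∈ G) : w.degree ≤ u.degree := by
  rcases hu.2 w hw with h | h <;> omega

/-- Removing the last generator of a stable set leaves a stable set: it is not obtained by an
exchange from another generator, as exchanges keep the degree and lower the weight. -/
lemma IsStable.erase {G : Finset (Fin d →₀ ℕ)} (hG : IsStable (G : Set (Fin d →₀ ℕ)))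
    {u : Fin d →₀ ℕ} (hu : IsLastGenerator G u) : IsStable (G.erase u : Set (Fin d →₀ ℕ)) := by
  rintro v i j hij ⟨w, hw, hwv⟩
  obtain ⟨hwu, hwG⟩ := Finset.mem_erase.1 hw
  by_cases hle : w j ≤ v j
  · exact ⟨w, hw, (le_of_le_add_single hwv hle).trans le_self_add⟩
  obtain ⟨w₀, rfl⟩ := exists_eq_add_single (i := j) (v := w) (by omega)
  have hw₀ : w₀ ≤ v := le_of_add_le_add_right hwv
  obtain ⟨w', hw', hle'⟩ := hG w₀ i j hij ⟨_, hwG, le_rfl⟩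
  refine ⟨w', Finset.mem_erase.2 ⟨?_, hw'⟩, hle'.trans (by gcongr)⟩
  rintro rfl
  have hdeg := hu.degree_le hwG
  have heq := eq_of_le_of_degree_le hle' (by simpa using hdeg)
  have hweight := (hu.2 _ hwG).resolve_left (by rw [heq]; simp)
  rw [heq, indexWeight_add_single, indexWeight_add_single] at hweight
  have : (i : ℕ) < j := hij
  omega

/-- Divisibility by an earlier generator of a multiple `x ^ s` of the last generator `u`: for the
generators of a stable set, the colon ideal is generated by the variables that precede the largest
variable of `u`. If `x ^ s` involves none of these, its variables can be stripped off one by one,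
starting with the largest, without leaving the ideal of the earlier generators. -/
lemma IsStable.exists_le_add_iff {G : Finset (Fin d →₀ ℕ)}
    (hG : IsStable (G : Set (Fin d →₀ ℕ)))
    (hanti : IsAntichain (· ≤ ·) (G : Set (Fin d →₀ ℕ)))
    {u : Fin d →₀ ℕ} (hu : IsLastGenerator G u) (s : Fin d →₀ ℕ) :
    (∃ w ∈ G.erase u, w ≤ s + u) ↔ ∃ i, (∃ j, i < j ∧ u j ≠ 0) ∧ s i ≠ 0 := by
  constructor
  · rintro h
    by_contra! hs
    induction hn : s.degree generalizing s with
    | zero =>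
      obtain ⟨w, hw, hle⟩ := h
      rw [(Finsupp.degree_eq_zero_iff s).1 hn, zero_add] at hle
      exact (Finset.mem_erase.1 hw).1
        (hanti.eq (Finset.mem_erase.1 hw).2 hu.1 hle)
    | succ n ih =>
      obtain ⟨w, hw, hle⟩ := h
      have hsupp : s.support.Nonempty := by
        rw [Finsupp.support_nonempty_iff]
        rintro rfl
        simp at hn
      set t := s.support.max' hsupp with ht
      have hst : s t ≠ 0 := Finsupp.mem_support_iff.1 (s.support.max'_mem hsupp)
      have htop : ∀ l, (s + u) l ≠ 0 → l ≤ t := by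
        intro l hl
        by_contra! hlt
        refine hl ?_
        have h1 : s l = 0 := by
          by_contra h0
          exact absurd (s.support.le_max' l (Finsupp.mem_support_iff.2 h0)) (not_le.2 hlt)
        have h2 : u l = 0 := by
          by_contra h0
          exact hst (hs t ⟨l, hlt, h0⟩)
        rw [Finsupp.add_apply, h1, h2]
      obtain ⟨s₀, hs₀⟩ := exists_eq_add_single hst
      refine ih s₀ ?_ ?_ ?_
      · obtain ⟨l, hl⟩ : ∃ l, w l < (s + u) l := by
          by_contra! hge
          have h1 := hu.degree_le (Finset.mem_erase.1 hw).2
          rw [le_antisymm hle hge, map_add] at h1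
          omega
        have hwl : ∃ y, s + u = y + Finsupp.single l 1 ∧ w ≤ y := by
          obtain ⟨y, hy⟩ := exists_eq_add_single (v := s + u) (i := l) (by omega)
          refine ⟨y, hy, le_of_le_add_single (hy ▸ hle) ?_⟩
          rw [hy, Finsupp.add_apply, Finsupp.single_eq_same] at hl
          omega
        obtain ⟨y, hy, hwy⟩ := hwl
        have hsu : s + u = s₀ + u + Finsupp.single t 1 := by
          rw [hs₀, add_right_comm]
        rcases (htop l (by omega)).eq_or_lt with rfl | hlt
        · exact ⟨w, hw, (add_right_cancel (hy.symm.trans hsu)) ▸ hwy⟩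
        · have hyt : y t ≠ 0 := by
            have h1 := DFunLike.congr_fun hy t
            rw [Finsupp.add_apply, Finsupp.add_apply, Finsupp.single_eq_of_ne hlt.ne'] at h1
            omega
          obtain ⟨y₀, rfl⟩ := exists_eq_add_single hyt
          obtain ⟨w', hw', hle'⟩ := hG.erase hu y₀ l t hlt ⟨w, hw, hwy⟩
          refine ⟨w', hw', hle'.trans_eq ?_⟩
          rw [add_right_comm] at hy
          exact add_right_cancel (hy.symm.trans hsu)
      · intro i hi
        have := hs i hi
        rw [hs₀, Finsupp.add_apply] at this
        omega
      · rw [hs₀, map_add, Finsupp.degree_single] at hn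
        omega
  · rintro ⟨i, ⟨j, hij, hj⟩, hsi⟩
    obtain ⟨u₀, hu₀⟩ := exists_eq_add_single hj
    obtain ⟨w, hw, hle⟩ := hG u₀ i j hij ⟨u, hu.1, hu₀.le⟩
    obtain ⟨s₀, rfl⟩ := exists_eq_add_single hsi
    refine ⟨w, Finset.mem_erase.2 ⟨?_, hw⟩, hle.trans ?_⟩
    · rintro rfl
      have heq := eq_of_le_of_degree_le hle (by rw [hu₀]; simp)
      have := hu₀.symm.trans heq
      exact hij.ne' (Finsupp.single_left_injective one_ne_zero (add_left_cancel this))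
    · rw [hu₀]
      intro l
      simp only [Finsupp.add_apply]
      omega

/-- A strongly stable ideal has linear quotients with respect to its minimal monomial generators,
ordered by degree and weight. -/
lemma IsStable.linearQuotients {r : ℕ} {G : Finset (Fin d →₀ ℕ)}
    (hG : IsStable (G : Set (Fin d →₀ ℕ)))
    (hanti : IsAntichain (· ≤ ·) (G : Set (Fin d →₀ ℕ))) (hdeg : ∀ w ∈ G, w.degree ≤ r) :
    LinearQuotients (fun _ : Unit => 0) r
      (Submodule.map (Finsupp.lsingle ()) (monomialIdeal k (G : Set (Fin d →₀ ℕ)))) := by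
  classical
  induction hn : G.card generalizing G with
  | zero =>
    rw [Finset.card_eq_zero] at hn
    subst hn
    rw [monomialIdeal, Finset.coe_empty, Set.image_empty, Ideal.span_empty, Submodule.map_bot]
    exact .bot
  | succ n ih =>
    obtain ⟨u, hu⟩ := exists_isLastGenerator (Finset.card_pos.1 (by omega : 0 < G.card))
    have ih' := ih (hG.erase hu) (hanti.subset (by simp))
      (fun w hw => hdeg w (Finset.mem_of_mem_erase hw))
      (by rw [Finset.card_erase_of_mem hu.1]; omega)
    have hsplit : monomialIdeal k (G : Set (Fin d →₀ ℕ)) =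
        monomialIdeal k (G.erase u : Set (Fin d →₀ ℕ)) ⊔ Submodule.span _ {monomial u 1} := by
      rw [sup_comm, monomialIdeal, monomialIdeal, Ideal.span, Ideal.span, ← Submodule.span_insert,
        ← Finset.insert_erase hu.1, Finset.erase_insert_eq_erase,
        Finset.erase_idem, Finset.coe_insert, Set.image_insert_eq]
    rw [hsplit, Submodule.map_sup, Submodule.map_span, Set.image_singleton]
    refine .adjoin _ u.degree (Finset.univ.filter fun i => ∃ j, i < j ∧ u j ≠ 0) ih' ?_
      (hdeg u hu.1) fun p => ?_
    · refine .single fun s hs => ?_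
      rw [coeff_monomial] at hs
      split_ifs at hs with h
      · rw [h, add_zero]
      · exact absurd rfl hs
    · have hmem : p • Finsupp.lsingle (R := MvPolynomial (Fin d) k) () (monomial u 1) ∈
            Submodule.map (Finsupp.lsingle ())
              (monomialIdeal k (G.erase u : Set (Fin d →₀ ℕ))) ↔
          p * monomial u 1 ∈ monomialIdeal k (G.erase u : Set (Fin d →₀ ℕ)) := by
        rw [← map_smul, Submodule.mem_map]
        exact ⟨fun ⟨x, hx, h⟩ => (Finsupp.single_injective () h : x = p * monomial u 1) ▸ hx,
          fun h => ⟨_, h, rfl⟩⟩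
      rw [hmem, mem_ideal_span_X_image, mem_monomialIdeal]
      have hsupp : ∀ s, s ∈ (p * monomial u 1).support ↔ ∃ t ∈ p.support, t + u = s := by
        intro s
        rw [mem_support_iff, coeff_mul_monomial', mul_one]
        constructor
        · intro h
          split_ifs at h with hus
          · exact ⟨s - u, mem_support_iff.2 h, tsub_add_cancel_of_le hus⟩
          · exact absurd rfl h
        · rintro ⟨t, ht, rfl⟩
          rw [if_pos le_add_self, add_tsub_cancel_right]
          exact mem_support_iff.1 ht
      have hiff := hG.exists_le_add_iff hanti hu
      constructor
      · intro h s hs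
        obtain ⟨i, hi, hsi⟩ := (hiff s).1 (h _ ((hsupp _).2 ⟨s, hs, rfl⟩))
        exact ⟨i, by simpa using hi, hsi⟩
      · intro h s hs
        obtain ⟨t, ht, rfl⟩ := (hsupp s).1 hs
        obtain ⟨i, hi, hti⟩ := h t ht
        exact (hiff t).2 ⟨i, by simpa using hi, hti⟩

/-- A strongly stable ideal generated in degrees at most `r` is `r`-regular. -/
theorem IsStable.isRegular {r : ℕ} {G : Finset (Fin d →₀ ℕ)}
    (hG : IsStable (G : Set (Fin d →₀ ℕ))) (hdeg : ∀ w ∈ G, w.degree ≤ r) :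
    IsRegular r (monomialIdeal k (G : Set (Fin d →₀ ℕ))) := by
  classical
  let G' := G.filter fun w => Minimal (· ∈ G) w
  have hmem : ∀ w, w ∈ G' ↔ Minimal (· ∈ G) w := fun w =>
    ⟨fun h => (Finset.mem_filter.1 h).2, fun h => Finset.mem_filter.2 ⟨h.prop, h⟩⟩
  have hex : ∀ s, (∃ w ∈ G, w ≤ s) ↔ ∃ w ∈ G', w ≤ s := by
    intro s
    constructor
    · rintro ⟨w, hw, hle⟩
      obtain ⟨w', hle', hw'⟩ := G.exists_le_minimal hw
      exact ⟨w', (hmem _).2 hw', hle'.trans hle⟩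
    · rintro ⟨w, hw, hle⟩
      exact ⟨w, ((hmem _).1 hw).prop, hle⟩
  have hideal : monomialIdeal k (G : Set (Fin d →₀ ℕ)) = monomialIdeal k (G' : Set _) := by
    ext p
    rw [mem_monomialIdeal, mem_monomialIdeal]
    exact forall₂_congr fun s _ => hex s
  have hG' : IsStable (G' : Set (Fin d →₀ ℕ)) := fun v i j hij h =>
    (hex _).1 (hG v i j hij ((hex _).2 h))
  rw [hideal]
  refine isRegular_of_linearQuotients (hG'.linearQuotients ?_
    fun w hw => hdeg w (Finset.mem_filter.1 hw).1)
  intro a ha b hb hab hle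
  exact hab (le_antisymm hle (((hmem _).1 hb).le_of_le ((hmem _).1 ha).prop hle))

/-- An `r`-regular monomial ideal is generated by its monomials of degree at most `r`. -/
theorem IsRegular.le_span {r : ℕ} {I : Ideal (MvPolynomial (Fin d) k)} (hI : IsRegular r I)
    (hmon : ∃ S : Set (Fin d →₀ ℕ), I = Ideal.span ((fun s => monomial s (1 : k)) '' S)) :
    I ≤ monomialIdeal k {s | monomial s (1 : k) ∈ I ∧ s.degree ≤ r} := by
  obtain ⟨F, hF⟩ := hI
  obtain ⟨S, hS⟩ := hmon
  intro p hp
  rw [← F.range_aug] at hp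
  obtain ⟨c, rfl⟩ := hp
  induction c using Finsupp.induction_linear with
  | zero => simp
  | add f g hf hg => rw [map_add]; exact add_mem hf hg
  | single j q =>
    rw [← mul_one q, ← smul_eq_mul, ← Finsupp.smul_single, map_smul]
    refine Ideal.mul_mem_left _ _ (mem_monomialIdeal.2 fun s hs => ⟨s, ⟨?_, ?_⟩, le_rfl⟩)
    · have h : F.aug (Finsupp.single j 1) ∈ I := F.range_aug.le ⟨_, rfl⟩
      subst hS
      exact monomial_mem_monomialIdeal.2 (mem_monomialIdeal.1 h s hs)
    · have h : s.degree = F.deg 0 j := by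
        by_contra h
        exact mem_support_iff.1 hs ((F.aug_homogeneous j).coeff_eq_zero h)
      have := hF 0 j
      omega

end StronglyStable

/-! ### Isotone maps as partial sums of exponents -/

section PartialSums

variable {m n : ℕ}

/-- The partial sums `e 0 + ⋯ + e a` of an exponent vector. -/
def partialSum (e : Fin m →₀ ℕ) (a : Fin m) : ℕ := ∑ b ∈ Finset.Iic a, e b

lemma partialSum_mono (e : Fin m →₀ ℕ) : Monotone (partialSum e) := fun _ _ h =>
  Finset.sum_le_sum_of_subset (Finset.Iic_subset_Iic.2 h)

lemma partialSum_add (e e' : Fin m →₀ ℕ) (a : Fin m) :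
    partialSum (e + e') a = partialSum e a + partialSum e' a := Finset.sum_add_distrib

lemma partialSum_single (i a : Fin m) :
    partialSum (Finsupp.single i 1) a = if i ≤ a then 1 else 0 := by
  classical
  simp only [partialSum, Finsupp.single_apply]
  rw [Finset.sum_ite_eq]
  simp

lemma partialSum_le_degree (e : Fin m →₀ ℕ) (a : Fin m) : partialSum e a ≤ e.degree := by
  rw [Finsupp.degree_eq_sum]
  exact Finset.sum_le_sum_of_subset (Finset.subset_univ _)

lemma partialSum_eq_sum_Iio_add (e : Fin m →₀ ℕ) (a : Fin m) :
    partialSum e a = ∑ b ∈ Finset.Iio a, e b + e a := by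
  rw [partialSum, ← Finset.Iio_insert, Finset.sum_insert (by simp), add_comm]

lemma partialSum_eq_partialSum_add (e : Fin m →₀ ℕ) {a b : Fin m} (h : (b : ℕ) = a + 1) :
    partialSum e b = partialSum e a + e b := by
  rw [partialSum_eq_sum_Iio_add, partialSum]
  congr 2
  ext c
  rw [Finset.mem_Iio, Finset.mem_Iic, Fin.lt_def, Fin.le_def]
  omega

lemma partialSum_injective : Function.Injective (partialSum : (Fin m →₀ ℕ) → Fin m → ℕ) := by
  intro e e' h
  ext a
  induction a using WellFoundedLT.induction with
  | ind a ih =>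
    have ha := congrFun h a
    rw [partialSum_eq_sum_Iio_add, partialSum_eq_sum_Iio_add,
      Finset.sum_congr rfl fun b hb => ih b (Finset.mem_Iio.1 hb)] at ha
    exact add_left_cancel ha

lemma partialSum_sum_single {α : Type*} (s : Finset α) (f : α → Fin m) (a : Fin m) :
    partialSum (∑ x ∈ s, Finsupp.single (f x) 1) a = (s.filter fun x => f x ≤ a).card := by
  have h : partialSum (∑ x ∈ s, Finsupp.single (f x) 1) a =
      ∑ x ∈ s, partialSum (Finsupp.single (f x) 1) a := by
    simp only [partialSum, Finsupp.finsetSum_apply]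
    exact Finset.sum_comm
  rw [h, Finset.card_filter]
  exact Finset.sum_congr rfl fun x _ => partialSum_single _ _

lemma partialSum_le_of_le {e e' : Fin m →₀ ℕ} (h : e ≤ e') (a : Fin m) :
    partialSum e a ≤ partialSum e' a := Finset.sum_le_sum fun b _ => h b

lemma partialSum_add_single_le (v : Fin m →₀ ℕ) {i j : Fin m} (hij : i < j) (a : Fin m) :
    partialSum (v + Finsupp.single j 1) a ≤ partialSum (v + Finsupp.single i 1) a := by
  rw [partialSum_add, partialSum_add, partialSum_single, partialSum_single]
  split_ifs with h₁ h₂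
  · exact le_rfl
  · exact absurd (hij.le.trans h₁) h₂
  · omega
  · exact le_rfl

/-- A set of monomials closed under multiplication with variables and under exchanging a variable
for a smaller one is closed under increasing the partial sums of the exponents: partial sums can
be increased by one at a single place, by one of these two operations. -/
lemma of_partialSum_le {P : (Fin m →₀ ℕ) → Prop}
    (hmul : ∀ v i, P v → P (v + Finsupp.single i 1))
    (hexch : ∀ v i j, i < j → P (v + Finsupp.single j 1) → P (v + Finsupp.single i 1))
    {e e' : Fin m →₀ ℕ} (he : P e) (h : ∀ a, partialSum e a ≤ partialSum e' a) : P e' := by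
  classical
  induction hN : ∑ a, (partialSum e' a - partialSum e a) using Nat.strong_induction_on
    generalizing e with
  | _ N ih =>
  by_cases hlt : ∃ a, partialSum e a < partialSum e' a
  swap
  · push Not at hlt
    rwa [← partialSum_injective (funext fun a => le_antisymm (h a) (hlt a))]
  -- At the last place `a` where the partial sums differ they can be increased by one.
  obtain ⟨a, ha, hmax⟩ : ∃ a, partialSum e a < partialSum e' a ∧
      ∀ b, a < b → partialSum e b = partialSum e' b := by
    let s := Finset.univ.filter fun a => partialSum e a < partialSum e' a
    have hs : s.Nonempty := hlt.imp fun a ha => Finset.mem_filter.2 ⟨Finset.mem_univ _, ha⟩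
    refine ⟨s.max' hs, (Finset.mem_filter.1 (s.max'_mem hs)).2, fun b hb => ?_⟩
    refine le_antisymm (h b) (not_lt.1 fun hb' => ?_)
    exact absurd (s.le_max' b (Finset.mem_filter.2 ⟨Finset.mem_univ _, hb'⟩)) (not_le.2 hb)
  obtain ⟨e'', he'', hsum⟩ : ∃ e'', P e'' ∧
      ∀ b, partialSum e'' b = partialSum e b + if b = a then 1 else 0 := by
    by_cases hlast : (a : ℕ) + 1 < m
    · let j : Fin m := ⟨a + 1, hlast⟩
      have haj : a < j := Fin.lt_def.2 (Nat.lt_succ_self _)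
      have hej : e j ≠ 0 := by
        have h₁ := partialSum_eq_partialSum_add e (a := a) (b := j) rfl
        have h₂ := hmax j haj
        have h₃ := partialSum_mono e' haj.le
        omega
      obtain ⟨e₀, rfl⟩ := exists_eq_add_single hej
      refine ⟨_, hexch _ a j haj he, fun b => ?_⟩
      rw [partialSum_add, partialSum_add, partialSum_single, partialSum_single, add_assoc]
      congr 1
      have hj : j ≤ b ↔ a < b := Iff.rfl
      simp only [hj]
      rcases lt_trichotomy a b with hab | rfl | hab
      · simp [hab, hab.le, hab.ne']
      · simp
      · simp [hab.not_ge, hab.not_gt, hab.ne]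
    · refine ⟨_, hmul _ a he, fun b => ?_⟩
      rw [partialSum_add, partialSum_single]
      congr 2
      refine propext ⟨fun hab => ?_, fun hab => hab.ge⟩
      rw [Fin.le_def] at hab
      ext
      omega
  refine ih _ ?_ he'' (fun b => ?_) rfl
  · rw [← hN]
    refine Finset.sum_lt_sum (fun b _ => ?_) ⟨a, Finset.mem_univ _, ?_⟩
    · rw [hsum]
      omega
    · rw [hsum, if_pos rfl]
      omega
  · rw [hsum]
    split_ifs with hb
    · subst hb
      exact ha
    · exact h b

/-- The isotone map of partial sums of `e`, cut off at `n`. It corresponds to the product of the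
first `n` factors of the monomial with exponent `e`. -/
def truncation (n : ℕ) (e : Fin m →₀ ℕ) : IsotoneMaps m n where
  toFun a := ⟨min (partialSum e a) n, Nat.lt_succ_of_le (min_le_right _ _)⟩
  monotone' _ _ h := Fin.mk_le_mk.2 (min_le_min_right _ (partialSum_mono e h))

lemma coe_truncation (e : Fin m →₀ ℕ) (a : Fin m) :
    (truncation n e a : ℕ) = min (partialSum e a) n := rfl

lemma truncation_le_truncation {e e' : Fin m →₀ ℕ}
    (h : ∀ a, partialSum e a ≤ partialSum e' a) : truncation n e ≤ truncation n e' :=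
  fun a => Fin.mk_le_mk.2 (min_le_min_right _ (h a))

/-- The exponent of the monomial `∏_{(a, i) ∈ Λφ} x_a`. -/
def ascentExponent (φ : IsotoneMaps m n) : Fin m →₀ ℕ :=
  ∑ x ∈ ascent φ, Finsupp.single x.1 1

lemma mem_ascent {φ : IsotoneMaps m n} {x : Fin m × Fin n} :
    x ∈ ascent φ ↔ (x.2 : ℕ) < φ x.1 ∧ ∀ q < x.1, (φ q : ℕ) ≤ x.2 := by
  simp only [ascent, Finset.mem_filter, Finset.mem_univ, true_and]
  exact Iff.rfl

lemma ascent_injOn_snd (φ : IsotoneMaps m n) :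
    Set.InjOn Prod.snd (ascent φ : Set (Fin m × Fin n)) := by
  intro x hx y hy hxy
  rw [Finset.mem_coe, mem_ascent] at hx hy
  refine Prod.ext ?_ hxy
  by_contra hne
  rcases lt_or_gt_of_ne hne with h | h
  · exact absurd (hy.2 _ h) (not_le.2 (hxy ▸ hx.1))
  · exact absurd (hx.2 _ h) (not_le.2 (hxy ▸ hy.1))

/-- The partial sums of the exponent `ascentExponent φ` recover `φ`: every `i < φ a` is the second
entry of exactly one element of `Λφ` with first entry at most `a`. -/
lemma partialSum_ascentExponent (φ : IsotoneMaps m n) (a : Fin m) :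
    partialSum (ascentExponent φ) a = φ a := by
  rw [ascentExponent, partialSum_sum_single, ← Finset.card_range (φ a : ℕ)]
  refine Finset.card_bij (fun x _ => (x.2 : ℕ)) (fun x hx => ?_) (fun x hx y hy h => ?_)
    fun i hi => ?_
  · rw [Finset.mem_filter, mem_ascent] at hx
    exact Finset.mem_range.2 (hx.1.1.trans_le (φ.monotone hx.2))
  · exact ascent_injOn_snd φ (Finset.mem_filter.1 hx).1 (Finset.mem_filter.1 hy).1 (Fin.ext h)
  · rw [Finset.mem_range] at hi
    obtain ⟨b, hb, hmin⟩ := WellFounded.has_min (wellFounded_lt (α := Fin m))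
      {b | i < (φ b : ℕ)} ⟨a, hi⟩
    refine ⟨(b, ⟨i, by have := (φ a).2; omega⟩),
      Finset.mem_filter.2 ⟨mem_ascent.2 ⟨hb, fun q hq => ?_⟩, not_lt.1 (hmin a hi)⟩, rfl⟩
    by_contra hlt
    exact hmin q (not_le.1 hlt) hq

lemma degree_ascentExponent_le (φ : IsotoneMaps m n) : (ascentExponent φ).degree ≤ n := by
  rw [ascentExponent, map_sum]
  simp only [Finsupp.degree_single, Finset.sum_const, smul_eq_mul, mul_one]
  simpa using Finset.card_le_card_of_injOn _ (fun _ _ => Finset.mem_univ _) (ascent_injOn_snd φ)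

lemma truncation_ascentExponent (φ : IsotoneMaps m n) : truncation n (ascentExponent φ) = φ := by
  ext a
  rw [coe_truncation, partialSum_ascentExponent]
  exact min_eq_left (Nat.lt_succ_iff.1 (φ a).2)

lemma ascentExponent_truncation_le (e : Fin m →₀ ℕ) :
    ascentExponent (truncation n e) ≤ e := by
  intro a
  rw [ascentExponent, Finsupp.finsetSum_apply]
  simp only [Finsupp.single_apply]
  rw [← Finset.card_filter]
  have hcard : (Finset.Ico (∑ b ∈ Finset.Iio a, e b) (partialSum e a)).card = e a := by
    rw [Nat.card_Ico, partialSum_eq_sum_Iio_add, Nat.add_sub_cancel_left]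
  rw [← hcard]
  refine Finset.card_le_card_of_injOn (fun x => (x.2 : ℕ)) (fun x hx => ?_) fun x hx y hy h =>
    ascent_injOn_snd _ (Finset.mem_filter.1 hx).1 (Finset.mem_filter.1 hy).1 (Fin.ext h)
  rw [Finset.mem_coe, Finset.mem_filter, mem_ascent] at hx
  obtain ⟨hx, rfl⟩ := hx
  simp only [coe_truncation] at hx
  refine Finset.mem_coe.2 (Finset.mem_Ico.2 ⟨?_, hx.1.trans_le (min_le_left _ _)⟩)
  change _ ≤ (x.2 : ℕ)
  rcases Nat.eq_zero_or_pos (x.1 : ℕ) with h0 | hpos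
  · rw [Finset.sum_eq_zero]
    · exact Nat.zero_le _
    · intro b hb
      have : (b : ℕ) < x.1 := Fin.lt_def.1 (Finset.mem_Iio.1 hb)
      omega
  · have hlt := x.1.2
    let q : Fin m := ⟨x.1 - 1, by omega⟩
    have hq := hx.2 q (Fin.lt_def.2 (by change (x.1 : ℕ) - 1 < x.1; omega))
    have h₁ := partialSum_eq_partialSum_add e (a := q) (b := x.1)
      (by change (x.1 : ℕ) = x.1 - 1 + 1; omega)
    have h₂ := partialSum_eq_sum_Iio_add e x.1
    have h₃ := x.2.2
    omega

end PartialSums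

/-! ### The projected letterplace ideals -/

section Letterplace

variable {k : Type*} [Field k] {m n : ℕ}

lemma prod_X_eq_monomial {α : Type*} (s : Finset α) (f : α → Fin m) :
    ∏ x ∈ s, (X (f x) : MvPolynomial (Fin m) k) =
      monomial (∑ x ∈ s, Finsupp.single (f x) 1) 1 :=
  (monomial_sum_one s _).symm

lemma projectedLetterplaceIdeal_eq (J : LowerSet (IsotoneMaps m n)) :
    projectedLetterplaceIdeal k J =
      monomialIdeal k (ascentExponent '' (J : Set (IsotoneMaps m n))ᶜ) := by
  rw [projectedLetterplaceIdeal, letterplaceIdeal, Ideal.map_span, monomialIdeal]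
  congr 1
  ext p
  simp only [Set.mem_image, Set.mem_ofPred_eq, Set.mem_compl_iff, SetLike.mem_coe]
  constructor
  · rintro ⟨_, ⟨φ, hφ, rfl⟩, rfl⟩
    refine ⟨_, ⟨φ, hφ, rfl⟩, ?_⟩
    rw [ascentExponent, ← prod_X_eq_monomial]
    simp
  · rintro ⟨_, ⟨φ, hφ, rfl⟩, rfl⟩
    refine ⟨_, ⟨φ, hφ, rfl⟩, ?_⟩
    rw [ascentExponent, ← prod_X_eq_monomial]
    simp

lemma exists_ascentExponent_le_iff (J : LowerSet (IsotoneMaps m n)) (e : Fin m →₀ ℕ) :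
    (∃ w ∈ ascentExponent '' (J : Set (IsotoneMaps m n))ᶜ, w ≤ e) ↔ truncation n e ∉ J := by
  constructor
  · rintro ⟨_, ⟨φ, hφ, rfl⟩, hle⟩ h
    refine hφ (J.lower ?_ h)
    rw [← truncation_ascentExponent φ]
    exact truncation_le_truncation (partialSum_le_of_le hle)
  · intro h
    exact ⟨_, ⟨_, h, rfl⟩, ascentExponent_truncation_le e⟩

lemma monomial_mem_projectedLetterplaceIdeal {J : LowerSet (IsotoneMaps m n)}
    {e : Fin m →₀ ℕ} :
    monomial e (1 : k) ∈ projectedLetterplaceIdeal k J ↔ truncation n e ∉ J := by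
  rw [projectedLetterplaceIdeal_eq, monomial_mem_monomialIdeal, exists_ascentExponent_le_iff]

lemma isStable_image_ascentExponent (J : LowerSet (IsotoneMaps m n)) :
    IsStable (ascentExponent '' (J : Set (IsotoneMaps m n))ᶜ) := by
  intro v i j hij h
  rw [exists_ascentExponent_le_iff] at h ⊢
  exact fun h' => h (J.lower (truncation_le_truncation (partialSum_add_single_le v hij)) h')

lemma projectedLetterplaceIdeal_isStronglyStable (J : LowerSet (IsotoneMaps m n)) :
    IsStronglyStable (projectedLetterplaceIdeal k J) := by
  rw [projectedLetterplaceIdeal_eq]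
  exact (isStable_image_ascentExponent J).isStronglyStable

lemma projectedLetterplaceIdeal_isRegular (J : LowerSet (IsotoneMaps m n)) :
    IsRegular n (projectedLetterplaceIdeal k J) := by
  have hfin : Finite (IsotoneMaps m n) := DFunLike.finite _
  have hG := (Set.toFinite (J : Set (IsotoneMaps m n))ᶜ).image ascentExponent
  rw [projectedLetterplaceIdeal_eq, ← hG.coe_toFinset]
  refine IsStable.isRegular ?_ fun w hw => ?_
  · rw [hG.coe_toFinset]
    exact isStable_image_ascentExponent J
  · obtain ⟨φ, -, rfl⟩ := hG.mem_toFinset.1 hw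
    exact degree_ascentExponent_le φ

lemma projectedLetterplaceIdeal_injective :
    Function.Injective (projectedLetterplaceIdeal k :
      LowerSet (IsotoneMaps m n) → Ideal (MvPolynomial (Fin m) k)) := by
  intro J J' h
  ext φ
  have hiff := (monomial_mem_projectedLetterplaceIdeal (k := k) (J := J)
    (e := ascentExponent φ)).symm.trans
      (h ▸ monomial_mem_projectedLetterplaceIdeal (k := k) (J := J') (e := ascentExponent φ))
  rw [truncation_ascentExponent] at hiff
  exact not_iff_not.1 hiff

/-- Membership of monomials in a strongly stable ideal is preserved by increasing the partial sums
of the exponents. -/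
lemma IsStronglyStable.mem_of_partialSum_le {I : Ideal (MvPolynomial (Fin m) k)}
    (hI : IsStronglyStable I) {e e' : Fin m →₀ ℕ} (he : monomial e (1 : k) ∈ I)
    (h : ∀ a, partialSum e a ≤ partialSum e' a) : monomial e' (1 : k) ∈ I := by
  refine of_partialSum_le (P := fun e => monomial e (1 : k) ∈ I) (fun v i hv => ?_)
    (fun v i j hij hv => ?_) he h
  · rw [← X_mul_monomial_one]
    exact I.mul_mem_left _ hv
  · rw [← X_mul_monomial_one] at hv ⊢
    exact hI.exchange v i j hij hv

/-- A strongly stable `n`-regular ideal is the projected letterplace ideal of the poset ideal of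
all `φ` whose monomial it does not contain. -/
lemma exists_projectedLetterplaceIdeal_eq {I : Ideal (MvPolynomial (Fin m) k)}
    (hI : IsStronglyStable I) (hreg : IsRegular n I) :
    ∃ J : LowerSet (IsotoneMaps m n), projectedLetterplaceIdeal k J = I := by
  refine ⟨⟨{φ | monomial (ascentExponent φ) (1 : k) ∉ I}, fun φ ψ hle hφ hψ =>
    hφ (hI.mem_of_partialSum_le hψ fun a => ?_)⟩, le_antisymm ?_ ?_⟩
  · rw [partialSum_ascentExponent, partialSum_ascentExponent]
    exact hle a
  · rw [projectedLetterplaceIdeal_eq, monomialIdeal, Ideal.span_le]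
    rintro _ ⟨_, ⟨φ, hφ, rfl⟩, rfl⟩
    exact not_not.1 hφ
  · refine (hreg.le_span hI.isMonomial).trans ?_
    rw [monomialIdeal, Ideal.span_le]
    rintro _ ⟨e, ⟨he, hdeg⟩, rfl⟩
    refine monomial_mem_projectedLetterplaceIdeal.2 (not_not.2 ?_)
    refine hI.mem_of_partialSum_le he fun a => ?_
    rw [partialSum_ascentExponent, coe_truncation]
    exact le_min le_rfl ((partialSum_le_degree e a).trans hdeg)

/-- The bijection between poset ideals and strongly stable regular ideals given by the projected
letterplace ideals. -/
def letterplaceEquiv (k : Type*) [Field k] (m n : ℕ) :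
    LowerSet (IsotoneMaps m n) ≃ StronglyStableRegularIdeals k m n :=
  Equiv.ofBijective
    (fun J => ⟨projectedLetterplaceIdeal k J, projectedLetterplaceIdeal_isStronglyStable J,
      projectedLetterplaceIdeal_isRegular J⟩)
    ⟨fun _ _ h => projectedLetterplaceIdeal_injective (congrArg Subtype.val h),
      fun I => (exists_projectedLetterplaceIdeal_eq I.2.1 I.2.2).imp fun _ h => Subtype.ext h⟩

end Letterplace

/-! ### Dual partitions and co-letterplace ideals -/

section Duality

variable {k : Type*} [Field k] {m n : ℕ}

lemma coe_dualPartition (φ : IsotoneMaps m n) (b : Fin n) :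
    (dualPartition φ b : ℕ) =
      (Finset.univ.filter fun a : Fin m => n ≤ (φ a : ℕ) + (b : ℕ)).card := rfl

/-- The number of elements of an upper subset of `Fin m` tells which elements belong to it. -/
lemma mem_iff_le_card_add {s : Finset (Fin m)} (hs : IsUpperSet (s : Set (Fin m))) (a : Fin m) :
    a ∈ s ↔ m ≤ s.card + a := by
  constructor
  · intro ha
    have h : Finset.Ici a ⊆ s := fun b hb => hs (Finset.mem_Ici.1 hb) ha
    have := Finset.card_le_card h
    rw [Fin.card_Ici] at this
    omega
  · intro hm
    by_contra ha
    have h : s ⊆ Finset.Ioi a := fun b hb => Finset.mem_Ioi.2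
      (not_le.1 fun hba => ha (hs hba hb))
    have := Finset.card_le_card h
    rw [Fin.card_Ioi] at this
    have := a.2
    omega

/-- The filters of `[m] × [n]` belonging to `φ` and to its dual partition are transposes of each
other. -/
lemma le_dualPartition_add_iff (φ : IsotoneMaps m n) (a : Fin m) (b : Fin n) :
    m ≤ (dualPartition φ b : ℕ) + a ↔ n ≤ (φ a : ℕ) + b := by
  rw [coe_dualPartition, ← mem_iff_le_card_add]
  · simp
  · intro c c' hcc' hc
    simp only [Finset.coe_filter, Finset.mem_univ, true_and, Set.mem_ofPred_eq] at hc ⊢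
    have h : (φ c : ℕ) ≤ φ c' := φ.monotone hcc'
    omega

lemma dualPartition_dualPartition (φ : IsotoneMaps m n) :
    dualPartition (dualPartition φ) = φ := by
  ext a
  rw [coe_dualPartition]
  simp only [le_dualPartition_add_iff]
  have hn := (φ a).2
  have h := Finset.card_filter_add_card_filter_not (s := (Finset.univ : Finset (Fin n)))
    (fun b : Fin n => (b : ℕ) < n - φ a)
  have h' : (Finset.univ.filter fun b : Fin n => ¬ (b : ℕ) < n - φ a) =
      Finset.univ.filter fun b : Fin n => n ≤ (φ a : ℕ) + b := by
    ext b
    simp only [Finset.mem_filter, Finset.mem_univ, true_and]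
    omega
  rw [h', Fin.card_filter_val_lt, Finset.card_univ, Fintype.card_fin] at h
  omega

lemma dualPartition_mono {φ ψ : IsotoneMaps m n} (h : φ ≤ ψ) :
    dualPartition φ ≤ dualPartition ψ := by
  intro b
  refine Fin.mk_le_mk.2 (Finset.card_le_card fun a ha => ?_)
  simp only [Finset.mem_filter, Finset.mem_univ, true_and] at ha ⊢
  have : (φ a : ℕ) ≤ ψ a := h a
  omega

/-- Taking the dual partition is an isomorphism `Hom([m], [n]₀) ≅ Hom([n], [m]₀)`. -/
def dualPartitionIso (m n : ℕ) : IsotoneMaps m n ≃o IsotoneMaps n m where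
  toFun := dualPartition
  invFun := dualPartition
  left_inv := dualPartition_dualPartition
  right_inv := dualPartition_dualPartition
  map_rel_iff' {φ ψ} := ⟨fun h => by
    have := dualPartition_mono h
    rwa [Equiv.coe_fn_mk, dualPartition_dualPartition, dualPartition_dualPartition] at this,
    dualPartition_mono⟩

/-- The order-reversing involution of `Hom([m], [n]₀)` which turns both chains around. -/
def reverse (φ : IsotoneMaps m n) : IsotoneMaps m n where
  toFun a := (φ a.rev).rev
  monotone' _ _ h := Fin.rev_le_rev.2 (φ.monotone (Fin.rev_le_rev.2 h))

lemma reverse_apply (φ : IsotoneMaps m n) (a : Fin m) : reverse φ a = (φ a.rev).rev := rfl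

lemma reverse_reverse (φ : IsotoneMaps m n) : reverse (reverse φ) = φ := by
  ext a
  simp [reverse_apply]

lemma reverse_le_reverse {φ ψ : IsotoneMaps m n} (h : φ ≤ ψ) : reverse ψ ≤ reverse φ :=
  fun a => Fin.rev_le_rev.2 (h a.rev)

/-- The map `i ↦ #{a | φ a ≤ i}`; see `coe_conjugate`. It depends on `φ` in an order-reversing
way. -/
def conjugate (φ : IsotoneMaps m n) : IsotoneMaps n m := reverse (dualPartition φ)

lemma conjugate_le_conjugate {φ ψ : IsotoneMaps m n} (h : φ ≤ ψ) : conjugate ψ ≤ conjugate φ :=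
  reverse_le_reverse (dualPartition_mono h)

lemma coe_conjugate (φ : IsotoneMaps m n) (i : Fin n) :
    (conjugate φ i : ℕ) = (Finset.univ.filter fun a : Fin m => (φ a : ℕ) ≤ i).card := by
  rw [conjugate, reverse_apply, Fin.val_rev, coe_dualPartition]
  have h := Finset.card_filter_add_card_filter_not (s := (Finset.univ : Finset (Fin m)))
    (fun a : Fin m => (φ a : ℕ) ≤ i)
  rw [Finset.card_univ, Fintype.card_fin] at h
  have h' : (Finset.univ.filter fun a : Fin m => n ≤ (φ a : ℕ) + (i.rev : ℕ)) =
      Finset.univ.filter fun a : Fin m => ¬(φ a : ℕ) ≤ i := by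
    ext a
    simp only [Finset.mem_filter, Finset.mem_univ, true_and, Fin.val_rev]
    have := i.2
    omega
  rw [h']
  omega

/-- The inverse of `conjugate`. -/
def conjugateSymm (ψ : IsotoneMaps n m) : IsotoneMaps m n := dualPartition (reverse ψ)

lemma conjugateSymm_le_conjugateSymm {φ ψ : IsotoneMaps n m} (h : φ ≤ ψ) :
    conjugateSymm ψ ≤ conjugateSymm φ :=
  dualPartition_mono (reverse_le_reverse h)

lemma conjugateSymm_conjugate (φ : IsotoneMaps m n) : conjugateSymm (conjugate φ) = φ := by
  rw [conjugateSymm, conjugate, reverse_reverse, dualPartition_dualPartition]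

lemma conjugate_conjugateSymm (ψ : IsotoneMaps n m) : conjugate (conjugateSymm ψ) = ψ := by
  rw [conjugateSymm, conjugate, dualPartition_dualPartition, reverse_reverse]

/-- The monomial of the graph of `φ` is the monomial of the ascent of its conjugate, since they
have the same partial sums. -/
lemma sum_lowGraph_eq (φ : IsotoneMaps m n) :
    ∑ x ∈ lowGraph φ, Finsupp.single x.2 1 = ascentExponent (conjugate φ) := by
  refine partialSum_injective (funext fun i => ?_)
  rw [partialSum_ascentExponent, coe_conjugate, partialSum_sum_single]
  have hmem : ∀ x : Fin m × Fin n, x ∈ (lowGraph φ).filter (fun x => x.2 ≤ i) ↔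
      (φ x.1 : ℕ) = x.2 ∧ x.2 ≤ i := fun x => by
    simp [lowGraph, Fin.ext_iff]
  refine Finset.card_bij (fun x _ => x.1) (fun x hx => ?_) (fun x hx y hy h => ?_) fun a ha => ?_
  · rw [hmem] at hx
    rw [Finset.mem_filter, hx.1]
    exact ⟨Finset.mem_univ _, hx.2⟩
  · rw [hmem] at hx hy
    exact Prod.ext h (Fin.ext (hx.1.symm.trans (h ▸ hy.1)))
  · have ha' := (Finset.mem_filter.1 ha).2
    exact ⟨(a, ⟨φ a, ha'.trans_lt i.2⟩), (hmem _).2 ⟨rfl, ha'⟩, rfl⟩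

/-- The bijection between the poset ideals of `Hom([m], [n]₀)` and of `Hom([n], [m]₀)` sending `J`
to the complement of its image under the order-reversing bijection `conjugate`. -/
def complementConjugate (m n : ℕ) : LowerSet (IsotoneMaps m n) ≃ LowerSet (IsotoneMaps n m) where
  toFun J := ⟨{ψ | conjugateSymm ψ ∉ J}, fun _ _ h hφ hψ =>
    hφ (J.lower (conjugateSymm_le_conjugateSymm h) hψ)⟩
  invFun J := ⟨{φ | conjugate φ ∉ J}, fun _ _ h hφ hψ =>
    hφ (J.lower (conjugate_le_conjugate h) hψ)⟩
  left_inv J := by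
    ext φ
    change ¬ conjugateSymm (conjugate φ) ∉ J ↔ φ ∈ J
    rw [conjugateSymm_conjugate, not_not]
  right_inv J := by
    ext ψ
    change ¬ conjugate (conjugateSymm ψ) ∉ J ↔ ψ ∈ J
    rw [conjugate_conjugateSymm, not_not]

lemma projectedCoLetterplaceIdeal_eq (J : LowerSet (IsotoneMaps m n)) :
    projectedCoLetterplaceIdeal k J = projectedLetterplaceIdeal k (complementConjugate m n J) := by
  rw [projectedLetterplaceIdeal_eq, projectedCoLetterplaceIdeal, coLetterplaceIdeal,
    Ideal.map_span, monomialIdeal]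
  have hcompl : ∀ ψ, ψ ∈ ((complementConjugate m n J : Set (IsotoneMaps n m)))ᶜ ↔
      conjugateSymm ψ ∈ J := fun ψ => not_not
  have hgraph : ∀ φ : IsotoneMaps m n,
      rename (Prod.snd : Fin m × Fin n → Fin n)
        (∏ x ∈ lowGraph φ, (X x : MvPolynomial (Fin m × Fin n) k)) =
      monomial (ascentExponent (conjugate φ)) 1 := fun φ => by
    rw [← sum_lowGraph_eq, ← prod_X_eq_monomial]
    simp
  congr 1
  ext p
  constructor
  · rintro ⟨_, ⟨φ, hφ, rfl⟩, rfl⟩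
    exact ⟨_, ⟨_, (hcompl _).2 ((conjugateSymm_conjugate φ).symm ▸ hφ), rfl⟩, (hgraph φ).symm⟩
  · rintro ⟨_, ⟨ψ, hψ, rfl⟩, rfl⟩
    refine ⟨_, ⟨_, (hcompl ψ).1 hψ, rfl⟩, (hgraph _).trans ?_⟩
    rw [conjugate_conjugateSymm]

end Duality

end StronglyStableDuality

end

theorem corollary6p5 (k : Type*) [Field k] (m n : ℕ) :
    ∃ (τ : StronglyStableDuality.IsotoneMaps m n ≃o StronglyStableDuality.IsotoneMaps n m)
      (A : LowerSet (StronglyStableDuality.IsotoneMaps m n) ≃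
        StronglyStableDuality.StronglyStableRegularIdeals k m n)
      (B : LowerSet (StronglyStableDuality.IsotoneMaps m n) ≃
        StronglyStableDuality.StronglyStableRegularIdeals k n m)
      (C : LowerSet (StronglyStableDuality.IsotoneMaps m n) ≃
        StronglyStableDuality.StronglyStableRegularIdeals k n m),
      (∀ φ, τ φ = StronglyStableDuality.dualPartition φ) ∧
      (∀ J, (A J : Ideal (MvPolynomial (Fin m) k)) =
        StronglyStableDuality.projectedLetterplaceIdeal k J) ∧
      (∀ J, (B J : Ideal (MvPolynomial (Fin n) k)) =
        StronglyStableDuality.projectedLetterplaceIdeal k (LowerSet.map τ J)) ∧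
      (∀ J, (C J : Ideal (MvPolynomial (Fin n) k)) =
        StronglyStableDuality.projectedCoLetterplaceIdeal k J) := by
  let τ := StronglyStableDuality.dualPartitionIso m n
  exact ⟨τ, StronglyStableDuality.letterplaceEquiv k m n,
    (LowerSet.map τ).toEquiv.trans (StronglyStableDuality.letterplaceEquiv k n m),
    (StronglyStableDuality.complementConjugate m n).trans
      (StronglyStableDuality.letterplaceEquiv k n m),
    fun _ => rfl, fun _ => rfl, fun _ => rfl,
    fun J => (StronglyStableDuality.projectedCoLetterplaceIdeal_eq J).symm⟩
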